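/- Let $(T,\mathcal T)$ be an arbitrary measurable space and let $X$ and $Y$ be Polish spaces with their Borel $\sigma$-algebras $\mathcal B(X)$ and $\mathcal B(Y)$. For a Polish space $Z$ let $\mathcal P(Z)$ denote the space of Borel probability measures on $Z$ with the weak topology and let $\mathcal B(\mathcal P(Z))$ be its Borel $\sigma$-algebra. Let $h\colon T\times X\times Y\to[0,+\infty)$ be a $\mathcal T\otimes\mathcal B(X)\otimes\mathcal B(Y)$-measurable function such that for every $t\in T$ the function $h_t\colon (x,y)\mapsto h(t,x,y)$ is continuous on $X\times Y$. Let $t\mapsto\mu_t$, $T\to\mathcal P(X)$, be $(\mathcal T,\mathcal B(\mathcal P(X)))$-measurable and let $t\mapsto\nu_t$, $T\to\mathcal P(Y)$, be $(\mathcal T,\mathcal B(\mathcal P(Y)))$-measurable. Denote by $\Pi(\mu_t,\nu_t)$ the set of all $\sigma\in\mathcal P(X\times Y)$ whose projections on $X$ and $Y$ are $\mu_t$ and $\nu_t$, and suppose that for every $t\in T$ the transportation cost $$ K(t):=K_{h_t}(\mu_t,\nu_t)=\inf\Bigl\{\int_{X\times Y}h_t\,d\sigma\colon\ \sigma\in\Pi(\mu_t,\nu_t)\Bigr\}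 $$ is finite. Then the function $K$ is $\mathcal T$-measurable. In addition, there is a mapping $t\mapsto\sigma_t$, $T\to\mathcal P(X\times Y)$, such that for every $t\in T$ the measure $\sigma_t$ is optimal, that is, $$ \sigma_t\in\Pi(\mu_t,\nu_t),\qquad \int_{X\times Y}h_t\,d\sigma_t=K(t), $$ and this mapping is measurable with respect to $\sigma(\mathcal S(\mathcal T))$ and $\mathcal B(\mathcal P(X\times Y))$. Here $\mathcal S(\mathcal T)$ is the class of all sets obtained from $\mathcal T$ by the Souslin operation, i.e., sets of the form $$ \bigcup_{(n_i)\in\mathbb N^{\mathbb N}}\ \bigcap_{k=1}^\infty E_{n_1,\ldots,n_k},\qquad E_{n_1,\ldots,n_k}\in\mathcal T, $$ and $\sigma(\mathcal S(\mathcal T))$ is the $\sigma$-algebra generated by $\mathcal S(\mathcal T)$. -/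

import Mathlib

open MeasureTheory
open scoped NNReal ENNReal

/-- The class `𝒮(C)` of sets obtained from a class `C` of subsets of `T` by the Souslin operation:
the sets `⋃_{x ∈ ℕ^ℕ} ⋂_{k ≥ 1} E (x 0, …, x (k - 1))`, where `E` assigns a member of `C` to each
finite sequence of natural numbers. -/
def souslinSets {T : Type*} (C : Set (Set T)) : Set (Set T) :=
  {A | ∃ E : List ℕ → Set T, (∀ s, E s ∈ C) ∧
    A = ⋃ x : ℕ → ℕ, ⋂ k : ℕ, E ((List.range (k + 1)).map x)}

/-- The σ-algebra `σ(𝒮(𝒯))` generated by the Souslin sets over a σ-algebra `𝒯`. -/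
@[reducible] def souslinSigmaAlgebra {T : Type*} (𝒯 : MeasurableSpace T) : MeasurableSpace T :=
  MeasurableSpace.generateFrom (souslinSets {A : Set T | MeasurableSet[𝒯] A})

/-- The set `Π(μ, ν)` of probability measures on `X × Y` with marginals `μ` and `ν`. -/
def transportPlans {X Y : Type*} [MeasurableSpace X] [MeasurableSpace Y]
    (μ : ProbabilityMeasure X) (ν : ProbabilityMeasure Y) : Set (ProbabilityMeasure (X × Y)) :=
  {σ | (σ : Measure (X × Y)).map Prod.fst = (μ : Measure X) ∧
    (σ : Measure (X × Y)).map Prod.snd = (ν : Measure Y)}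

/-- The total cost `∫ c dσ ∈ [0, ∞]` of the plan `σ` for the nonnegative cost function `c`. -/
noncomputable def planCost {X Y : Type*} [MeasurableSpace X] [MeasurableSpace Y]
    (c : X × Y → ℝ≥0) (σ : ProbabilityMeasure (X × Y)) : ℝ≥0∞ :=
  ∫⁻ p, (c p : ℝ≥0∞) ∂(σ : Measure (X × Y))

/-- The transportation cost `K_c(μ, ν)`: the infimum of `∫ c dσ` over `σ ∈ Π(μ, ν)`. -/
noncomputable def transportCost {X Y : Type*} [MeasurableSpace X] [MeasurableSpace Y]
    (c : X × Y → ℝ≥0) (μ : ProbabilityMeasure X) (ν : ProbabilityMeasure Y) : ℝ≥0∞ :=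
  ⨅ σ ∈ transportPlans μ ν, planCost c σ

/-- The plan `σ` is optimal for the cost function `c` and the marginals `μ`, `ν`. -/
def IsOptimalPlan {X Y : Type*} [MeasurableSpace X] [MeasurableSpace Y]
    (c : X × Y → ℝ≥0) (μ : ProbabilityMeasure X) (ν : ProbabilityMeasure Y)
    (σ : ProbabilityMeasure (X × Y)) : Prop :=
  σ ∈ transportPlans μ ν ∧ planCost c σ = transportCost c μ ν

open Filter Topology TopologicalSpace Set

/-! The plans between two fixed marginals form a fibre of the map `marginals`, which is proper by
Prokhorov's theorem. Being closed, it turns the condition that a fibre meets a closed set into a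
closed condition on the marginals, so `t ↦ Π(μ_t, ν_t)` is a measurable compact-valued
multifunction. The cost is only lower semicontinuous in the plan, but its truncations at level `n`
are continuous and increase to it. With `K` the supremum over `n` of the truncated minima, the plans
of truncated cost at most `K t` form decreasing nonempty compact sets. Any plan in their
intersection has full cost at most `K t`, hence is optimal, and `K` is the transport cost. Minima
and sublevel sets preserve measurability, and a selection theorem picks the plan. -/

/-- A compact-valued multifunction `M` on a measurable space is measurable if `{t | M t ∩ F ≠ ∅}`
is measurable for every closed set `F`. -/
structure MeasurableCompactValued {T W : Type*} [MeasurableSpace T] [TopologicalSpace W]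
    (M : T → Set W) : Prop where
  isCompact : ∀ t, IsCompact (M t)
  measurableSet : ∀ F : Set W, IsClosed F → MeasurableSet {t | (M t ∩ F).Nonempty}

/-- The infimum of a function over a compact set as a supremum of infima over a dense sequence. -/
theorem iInf_mem_eq_iSup_iInf_add_infEDist {W : Type*} [MetricSpace W] {d : ℕ → W}
    (hd : DenseRange d) {M : Set W} (hM : IsCompact M) {g : W → ℝ≥0∞} (hg : Continuous g) :
    ⨅ w ∈ M, g w = ⨆ N : ℕ, ⨅ i, g (d i) + N * Metric.infEDist (d i) M := by
  apply le_antisymm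
  · refine le_of_forall_lt fun r hr => ?_
    obtain ⟨s, hrs, hs⟩ := exists_between hr
    have hs_top : s ≠ ∞ := hs.ne_top
    have hsub : M ⊆ {w | s < g w} := fun w hw => hs.trans_le (iInf₂_le w hw)
    obtain ⟨δ, hδ, hthick⟩ :=
      hM.exists_thickening_subset_open (isOpen_lt continuous_const hg) hsub
    have hδ' : ENNReal.ofReal δ ≠ 0 := by simpa using hδ
    obtain ⟨N, hN⟩ := ENNReal.exists_nat_mul_gt hδ' hs_top
    refine hrs.trans_le (le_iSup_of_le N (le_iInf fun i => ?_))
    -- Near `M` the value of `g` already exceeds `s`; elsewhere the penalty is at least `N * δ > s`.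
    by_cases hi : Metric.infEDist (d i) M < ENNReal.ofReal δ
    · exact (show s < g (d i) from hthick hi).le.trans le_self_add
    · exact hN.le.trans ((mul_le_mul_right (not_lt.1 hi) _).trans le_add_self)
  · refine iSup_le fun N => le_iInf₂ fun w hw => ?_
    have hc : Continuous fun v => g v + N * edist v w := by
      refine hg.add ?_
      exact (ENNReal.continuous_const_mul (ENNReal.natCast_ne_top N)).comp
        (continuous_id.edist continuous_const)
    have hle : ∀ v, (⨅ i, g (d i) + N * Metric.infEDist (d i) M) ≤ g v + N * edist v w := by
      intro v
      refine hd.induction_on (p := fun v =>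
        (⨅ i, g (d i) + N * Metric.infEDist (d i) M) ≤ g v + N * edist v w) v
        (isClosed_le continuous_const hc) fun i => ?_
      refine (iInf_le _ i).trans ?_
      gcongr
      exact Metric.infEDist_le_edist_of_mem hw
    simpa using hle w

namespace MeasurableCompactValued

variable {T W : Type*} [MeasurableSpace T] [TopologicalSpace W] {M : T → Set W}

theorem inter_closed (hM : MeasurableCompactValued M) {C : Set W} (hC : IsClosed C) :
    MeasurableCompactValued fun t => M t ∩ C where
  isCompact t := (hM.isCompact t).inter_right hC
  measurableSet F hF := by
    simpa only [inter_assoc] using hM.measurableSet _ (hC.inter hF)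

theorem measurable_infEDist {W : Type*} [MetricSpace W] {M : T → Set W}
    (hM : MeasurableCompactValued M) (w : W) : Measurable fun t => Metric.infEDist w (M t) := by
  refine measurable_of_Iic fun r => ?_
  -- The set `{t | r = ∞}` accounts for empty `M t`, where the distance is `∞`.
  have : (fun t => Metric.infEDist w (M t)) ⁻¹' Iic r =
      {t | (M t ∩ {v | edist w v ≤ r}).Nonempty} ∪ {t | r = ∞} := by
    ext t
    simp only [mem_preimage, mem_Iic, mem_union, mem_ofPred_eq]
    constructor
    · intro h
      rcases (M t).eq_empty_or_nonempty with he | hne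
      · right
        simpa [he] using h
      · left
        obtain ⟨v, hv, hvw⟩ := (hM.isCompact t).exists_infEDist_eq_edist hne w
        exact ⟨v, hv, by simpa [← hvw] using h⟩
    · rintro (⟨v, hv, hvw⟩ | h)
      · exact (Metric.infEDist_le_edist_of_mem hv).trans hvw
      · simp [h]
  rw [this]
  exact (hM.measurableSet _ (isClosed_le (continuous_const.edist continuous_id)
    continuous_const)).union (MeasurableSet.const _)

/-- The minimum of a Carathéodory function over a measurable compact-valued multifunction is
measurable. -/
theorem measurable_iInf [MetrizableSpace W] [SecondCountableTopology W]
    (hM : MeasurableCompactValued M) {G : T → W → ℝ≥0∞} (hGm : ∀ w, Measurable fun t => G t w)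
    (hGc : ∀ t, Continuous (G t)) : Measurable fun t => ⨅ w ∈ M t, G t w := by
  let : MetricSpace W := metrizableSpaceMetric W
  cases isEmpty_or_nonempty W
  · simp only [iInf_of_empty]
    exact measurable_const
  have hd := denseRange_denseSeq W
  simp_rw [fun t => iInf_mem_eq_iSup_iInf_add_infEDist hd (hM.isCompact t) (hGc t)]
  exact .iSup fun N => .iInf fun i =>
    (hGm _).add ((hM.measurable_infEDist _).const_mul _)

/-- Sublevel sets of a Carathéodory function in a measurable compact-valued multifunction. -/
theorem sublevel [MetrizableSpace W] [SecondCountableTopology W]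
    (hM : MeasurableCompactValued M) {G : T → W → ℝ≥0∞} (hGm : ∀ w, Measurable fun t => G t w)
    (hGc : ∀ t, Continuous (G t)) {c : T → ℝ≥0∞} (hc : Measurable c) :
    MeasurableCompactValued fun t => M t ∩ {w | G t w ≤ c t} where
  isCompact t := (hM.isCompact t).inter_right (isClosed_le (hGc t) continuous_const)
  measurableSet F hF := by
    have hMF := hM.inter_closed hF
    -- Compactness makes the infimum attained. Nonemptiness is required separately because `c t` may
    -- be `∞`, the infimum over `∅`.
    have : {t | (M t ∩ {w | G t w ≤ c t} ∩ F).Nonempty} =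
        {t | (M t ∩ F).Nonempty} ∩ {t | ⨅ w ∈ M t ∩ F, G t w ≤ c t} := by
      ext t
      constructor
      · rintro ⟨w, ⟨hw, hwc⟩, hwF⟩
        have hle : ⨅ v ∈ M t ∩ F, G t v ≤ G t w :=
          iInf₂_le w (show w ∈ M t ∩ F from ⟨hw, hwF⟩)
        exact ⟨⟨w, hw, hwF⟩, hle.trans hwc⟩
      · rintro ⟨hne, hle⟩
        obtain ⟨w, hw, hmin⟩ := (hMF.isCompact t).exists_isMinOn hne (hGc t).continuousOn
        have hwc : G t w ≤ c t := (le_iInf₂ fun v hv => hmin hv).trans hle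
        exact ⟨w, ⟨hw.1, hwc⟩, hw.2⟩
    rw [this]
    exact (hM.measurableSet F hF).inter (measurableSet_le (hMF.measurable_iInf hGm hGc) hc)

/-- Cantor's intersection theorem: by compactness, meeting `F` passes to a decreasing intersection.
-/
theorem iInter_nonempty [T2Space W] {M : ℕ → T → Set W} (hM : ∀ n, MeasurableCompactValued (M n))
    (hanti : ∀ n t, M (n + 1) t ⊆ M n t) {F : Set W} (hF : IsClosed F) {t : T}
    (h : ∀ n, (M n t ∩ F).Nonempty) : ((⋂ n, M n t) ∩ F).Nonempty := by
  rw [iInter_inter]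
  exact IsCompact.nonempty_iInter_of_sequence_nonempty_isCompact_isClosed _
    (fun n => inter_subset_inter_left _ (hanti n t)) h
    (((hM 0).isCompact t).inter_right hF)
    fun n => ((hM n).isCompact t).isClosed.inter hF

theorem iInter [T2Space W] {M : ℕ → T → Set W} (hM : ∀ n, MeasurableCompactValued (M n))
    (hanti : ∀ n t, M (n + 1) t ⊆ M n t) : MeasurableCompactValued fun t => ⋂ n, M n t where
  isCompact t := ((hM 0).isCompact t).of_isClosed_subset
    (isClosed_iInter fun n => ((hM n).isCompact t).isClosed) (iInter_subset _ 0)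
  measurableSet F hF := by
    have : {t | ((⋂ n, M n t) ∩ F).Nonempty} = ⋂ n, {t | (M n t ∩ F).Nonempty} := by
      ext t
      simp only [mem_iInter, mem_ofPred_eq]
      exact ⟨fun ⟨w, hw, hwF⟩ n => ⟨w, mem_iInter.1 hw n, hwF⟩,
        fun h => iInter_nonempty hM hanti hF h⟩
    rw [this]
    exact .iInter fun n => (hM n).measurableSet F hF

open Classical in
/-- The values meeting `C` are replaced by their intersection with `C`. -/
theorem refine_closed (hM : MeasurableCompactValued M) {C : Set W} (hC : IsClosed C) :
    MeasurableCompactValued fun t => if (M t ∩ C).Nonempty then M t ∩ C else M t where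
  isCompact t := by
    split_ifs
    exacts [(hM.isCompact t).inter_right hC, hM.isCompact t]
  measurableSet F hF := by
    have : {t | ((if (M t ∩ C).Nonempty then M t ∩ C else M t) ∩ F).Nonempty} =
        {t | (M t ∩ C).Nonempty}.ite {t | (M t ∩ C ∩ F).Nonempty} {t | (M t ∩ F).Nonempty} := by
      ext t
      by_cases h : (M t ∩ C).Nonempty <;> simp [Set.ite, h]
    rw [this]
    exact (hM.measurableSet C hC).ite ((hM.inter_closed hC).measurableSet F hF)
      (hM.measurableSet F hF)

open Classical in
/-- A measurable multifunction with nonempty compact values in a separable metrizable space has a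
measurable selection. -/
theorem exists_measurable_selection [MetrizableSpace W] [SecondCountableTopology W]
    (hM : MeasurableCompactValued M) (hne : ∀ t, (M t).Nonempty) :
    ∃ f : T → W, Measurable[‹MeasurableSpace T›, borel W] f ∧ ∀ t, f t ∈ M t := by
  borelize W
  cases isEmpty_or_nonempty T
  · exact ⟨fun t => (hne t).some, measurable_of_empty _, fun t => (hne t).some_mem⟩
  obtain ⟨b, hbc, -, hb⟩ := exists_countable_basis W
  obtain ⟨w₀, -⟩ := hne (Classical.arbitrary T)
  have hbne : b.Nonempty := by
    obtain ⟨u, hu, -⟩ := hb.mem_nhds_iff.1 (univ_mem : (univ : Set W) ∈ 𝓝 w₀)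
    exact ⟨u, hu⟩
  obtain ⟨U, rfl⟩ := hbc.exists_eq_range hbne
  -- Cut successively by the closures of the basic open sets, whenever something remains; the limit
  -- is a single point.
  let N : ℕ → T → Set W := fun n => Nat.rec M
    (fun k L t => if (L t ∩ closure (U k)).Nonempty then L t ∩ closure (U k) else L t) n
  have hN : ∀ n, MeasurableCompactValued (N n) := by
    intro n
    induction n with
    | zero => exact hM
    | succ k ih => exact ih.refine_closed isClosed_closure
  have hNsucc : ∀ k t, N (k + 1) t = if (N k t ∩ closure (U k)).Nonempty
      then N k t ∩ closure (U k) else N k t := fun _ _ => rfl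
  have hanti : ∀ n t, N (n + 1) t ⊆ N n t := by
    intro n t
    rw [hNsucc]
    split_ifs
    exacts [inter_subset_left, subset_rfl]
  have hNne : ∀ n t, (N n t).Nonempty := by
    intro n t
    induction n with
    | zero => exact hne t
    | succ k ih =>
      rw [hNsucc]
      split_ifs with h
      exacts [h, ih]
  have hInt := MeasurableCompactValued.iInter hN hanti
  have hIne : ∀ t, (⋂ n, N n t).Nonempty := fun t => by
    simpa using iInter_nonempty hN hanti isClosed_univ (t := t) (by simpa using hNne · t)
  have huniq : ∀ t, ∀ v ∈ ⋂ n, N n t, ∀ w ∈ ⋂ n, N n t, v = w := by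
    intro t v hv w hw
    by_contra hvw
    -- By regularity some basic `U k` contains `v` while its closure misses `w`, so stage `k`
    -- discards `w`.
    obtain ⟨s, hs, hsc, hsw⟩ := exists_mem_nhds_isClosed_subset
      (isOpen_compl_singleton.mem_nhds (show v ∈ ({w} : Set W)ᶜ from hvw))
    obtain ⟨_, ⟨k, rfl⟩, hvk, hks⟩ := hb.mem_nhds_iff.1 hs
    have hne : (N k t ∩ closure (U k)).Nonempty := ⟨v, mem_iInter.1 hv k, subset_closure hvk⟩
    have hw' := mem_iInter.1 hw (k + 1)
    rw [hNsucc, if_pos hne] at hw'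
    exact hsw (closure_minimal hks hsc hw'.2) rfl
  choose f hf using hIne
  refine ⟨f, ?_, fun t => mem_iInter.1 (hf t) 0⟩
  refine measurable_of_isClosed fun F hF => ?_
  convert hInt.measurableSet F hF using 1
  ext t
  exact ⟨fun h => ⟨f t, hf t, h⟩, fun ⟨w, hw, hwF⟩ => by rwa [huniq t w hw _ (hf t)] at hwF⟩

end MeasurableCompactValued

/-! ### Second countability of the weak topology -/

namespace MeasureTheory.ProbabilityMeasure

/-- The weak topology on the probability measures of a separable metrizable space is second
countable. -/
theorem secondCountableTopology {Z : Type*} [TopologicalSpace Z] [MetrizableSpace Z]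
    [SecondCountableTopology Z] [MeasurableSpace Z] [BorelSpace Z] :
    SecondCountableTopology (ProbabilityMeasure Z) := by
  -- Finite unions of basic sets exhaust each open set by a directed family, so their measures
  -- determine the portmanteau condition.
  let U : Finset (countableBasis Z) → Set Z := fun s => ⋃ u ∈ s, (u : Set Z)
  let V : Finset (countableBasis Z) × ℚ → Set (ProbabilityMeasure Z) :=
    fun p => {μ | (Real.toNNReal p.2 : ℝ≥0∞) < (μ : Measure Z) (U p.1)}
  have : Countable (countableBasis Z) := (countable_countableBasis Z).to_subtype
  have hVc : (range V).Countable := countable_range V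
  refine ⟨range V, hVc, le_antisymm ?_ ?_⟩
  · rw [le_generateFrom_iff_subset_isOpen]
    rintro _ ⟨⟨s, q⟩, rfl⟩
    have hopen : IsOpen (U s) :=
      isOpen_biUnion fun u _ => isOpen_of_mem_countableBasis u.2
    have hV : IsOpen (V (s, q)) := by
      refine isOpen_iff_mem_nhds.2 fun μ hμ => ?_
      have hlim : Tendsto id (𝓝 μ) (𝓝 μ) := tendsto_id
      exact eventually_lt_of_lt_liminf
        (lt_of_lt_of_le hμ (le_liminf_measure_open_of_tendsto hlim hopen))
    exact hV
  · refine le_of_nhds_le_nhds fun μ => ?_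
    have hcg : (@nhds _ (generateFrom (range V)) μ).IsCountablyGenerated := by
      let τ : TopologicalSpace (ProbabilityMeasure Z) := generateFrom (range V)
      have : @SecondCountableTopology _ τ := @SecondCountableTopology.mk _ τ ⟨range V, hVc, rfl⟩
      exact @FirstCountableTopology.nhds_generated_countable _ τ inferInstance μ
    refine tendsto_of_forall_isOpen_le_liminf' (μs := id) fun G hG => ?_
    refine le_of_forall_lt fun r hr => ?_
    let S := {u : countableBasis Z // (u : Set Z) ⊆ G}
    have hGS : G = ⋃ s : Finset S, U (s.map (Function.Embedding.subtype _)) := by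
      have h₁ : G = ⋃ u : S, (u.1 : Set Z) := by
        refine Subset.antisymm (fun z hz => ?_) (iUnion_subset fun u => u.2)
        obtain ⟨u, hu, hzu, huG⟩ := (isBasis_countableBasis Z).exists_subset_of_mem_open hz hG
        exact mem_iUnion.2 ⟨⟨⟨u, hu⟩, huG⟩, hzu⟩
      conv_lhs => rw [h₁, iUnion_eq_iUnion_finset]
      refine iUnion_congr fun s => Subset.antisymm
        (iUnion₂_subset fun u hu => ?_) (iUnion₂_subset fun u hu => ?_)
      · exact subset_biUnion_of_mem (u := fun u : countableBasis Z => (u : Set Z))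
          (Finset.mem_map_of_mem (Function.Embedding.subtype _) hu)
      · obtain ⟨v, hv, rfl⟩ := Finset.mem_map.1 hu
        exact subset_biUnion_of_mem (u := fun v : S => (v.1 : Set Z)) hv
    have hdir : Directed (· ⊆ ·)
        fun s : Finset S => U (s.map (Function.Embedding.subtype _)) := by
      refine Monotone.directed_le fun s t hst => ?_
      exact biUnion_subset_biUnion_left (Finset.map_subset_map.2 hst)
    rw [hGS, hdir.measure_iUnion] at hr
    obtain ⟨s, hs⟩ := lt_iSup_iff.1 hr
    obtain ⟨q, -, hrq, hq⟩ := ENNReal.lt_iff_exists_rat_btwn.1 hs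
    refine hrq.trans_le (le_liminf_of_le (by isBoundedDefault) ?_)
    have hV : ∀ᶠ ν in @nhds _ (generateFrom (range V)) μ,
        ν ∈ V (s.map (Function.Embedding.subtype _), q) :=
      @IsOpen.mem_nhds _ (generateFrom (range V)) μ _
        (isOpen_generateFrom_of_mem (mem_range_self _)) hq
    filter_upwards [hV] with ν hν
    refine (show _ < _ from hν).le.trans (measure_mono ?_)
    exact (subset_iUnion (fun s : Finset S => U (s.map (Function.Embedding.subtype _))) s).trans
      hGS.ge

end MeasureTheory.ProbabilityMeasure

/-! ### Properness of the marginal map -/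

section TransportPlans

variable {X Y : Type*} [MeasurableSpace X] [MeasurableSpace Y]

/-- The pair of marginals of a probability measure on a product. -/
noncomputable def marginals (σ : ProbabilityMeasure (X × Y)) :
    ProbabilityMeasure X × ProbabilityMeasure Y :=
  (σ.map measurable_fst.aemeasurable, σ.map measurable_snd.aemeasurable)

theorem mem_transportPlans_iff {μ : ProbabilityMeasure X} {ν : ProbabilityMeasure Y}
    {σ : ProbabilityMeasure (X × Y)} : σ ∈ transportPlans μ ν ↔ marginals σ = (μ, ν) := by
  simp only [transportPlans, marginals, mem_ofPred_eq, Prod.mk.injEq,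
    ← ProbabilityMeasure.toMeasure_injective.eq_iff, ProbabilityMeasure.toMeasure_map]

theorem transportPlans_nonempty (μ : ProbabilityMeasure X) (ν : ProbabilityMeasure Y) :
    (transportPlans μ ν).Nonempty :=
  ⟨μ.prod ν, mem_transportPlans_iff.2 <| by simp [marginals]⟩

theorem continuous_marginals [TopologicalSpace X] [BorelSpace X] [TopologicalSpace Y]
    [BorelSpace Y] [OpensMeasurableSpace (X × Y)] :
    Continuous (marginals (X := X) (Y := Y)) :=
  (ProbabilityMeasure.continuous_map continuous_fst).prodMk
    (ProbabilityMeasure.continuous_map continuous_snd)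

variable [TopologicalSpace X] [PolishSpace X] [BorelSpace X]
    [TopologicalSpace Y] [PolishSpace Y] [BorelSpace Y]

/-- Plans with marginals in a compact set have tight marginals, hence are tight themselves;
Prokhorov gives compactness. -/
theorem isProperMap_marginals : IsProperMap (marginals (X := X) (Y := Y)) := by
  have := ProbabilityMeasure.secondCountableTopology (Z := X)
  have := ProbabilityMeasure.secondCountableTopology (Z := Y)
  refine isProperMap_iff_isCompact_preimage.2 ⟨continuous_marginals, fun K hK => ?_⟩
  have hclosed : IsClosed (marginals ⁻¹' K) := hK.isClosed.preimage continuous_marginals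
  rw [← hclosed.closure_eq]
  apply isCompact_closure_of_isTightMeasureSet
  let := upgradeIsCompletelyMetrizable X
  let := upgradeIsCompletelyMetrizable Y
  have hK₁ := hK.image continuous_fst
  have hK₂ := hK.image continuous_snd
  have h₁ := isTightMeasureSet_of_isCompact_closure (S := Prod.fst '' K)
    (by rwa [hK₁.isClosed.closure_eq])
  have h₂ := isTightMeasureSet_of_isCompact_closure (S := Prod.snd '' K)
    (by rwa [hK₂.isClosed.closure_eq])
  refine .prodMk (h₁.subset ?_) (h₂.subset ?_)
  · rintro _ ⟨_, ⟨σ, hσ, rfl⟩, rfl⟩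
    exact ⟨(marginals σ).1, mem_image_of_mem _ hσ, σ.toMeasure_map (by fun_prop)⟩
  · rintro _ ⟨_, ⟨σ, hσ, rfl⟩, rfl⟩
    exact ⟨(marginals σ).2, mem_image_of_mem _ hσ, σ.toMeasure_map (by fun_prop)⟩

/-- Transport plans between measurably varying marginals form a measurable multifunction. -/
theorem measurableCompactValued_transportPlans {T : Type*} [MeasurableSpace T]
    {μ : T → ProbabilityMeasure X} (hμ : Measurable[_, borel (ProbabilityMeasure X)] μ)
    {ν : T → ProbabilityMeasure Y} (hν : Measurable[_, borel (ProbabilityMeasure Y)] ν) :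
    MeasurableCompactValued fun t => transportPlans (μ t) (ν t) where
  isCompact t := by
    convert isProperMap_marginals.isCompact_preimage (isCompact_singleton (x := (μ t, ν t)))
    ext σ
    exact mem_transportPlans_iff
  measurableSet F hF := by
    have hcl := isProperMap_marginals.isClosedMap F hF
    have := ProbabilityMeasure.secondCountableTopology (Z := X)
    have := ProbabilityMeasure.secondCountableTopology (Z := Y)
    let mX : MeasurableSpace (ProbabilityMeasure X) := borel _
    have : BorelSpace (ProbabilityMeasure X) := ⟨rfl⟩
    let mY : MeasurableSpace (ProbabilityMeasure Y) := borel _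
    have : BorelSpace (ProbabilityMeasure Y) := ⟨rfl⟩
    have hms : MeasurableSet (marginals '' F) := hcl.measurableSet
    convert (hμ.prodMk hν) hms using 1
    ext t
    simp only [mem_preimage, mem_image, mem_ofPred_eq, Set.Nonempty, mem_inter_iff,
      mem_transportPlans_iff, and_comm]

end TransportPlans

/-! ### Continuous approximation of the cost -/

section TruncatedCost

variable {X Y : Type*} [MeasurableSpace X] [MeasurableSpace Y]

/-- The total cost of a plan for the cost function truncated at level `n`. -/
noncomputable def truncatedCost (c : X × Y → ℝ≥0) (n : ℕ) (σ : ProbabilityMeasure (X × Y)) :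
    ℝ≥0∞ :=
  planCost (fun p => min (c p) n) σ

theorem truncatedCost_mono (c : X × Y → ℝ≥0) (σ : ProbabilityMeasure (X × Y)) :
    Monotone fun n => truncatedCost c n σ := by
  intro m n hmn
  refine lintegral_mono fun p => ?_
  dsimp only
  gcongr

theorem iSup_truncatedCost {c : X × Y → ℝ≥0} (hc : Measurable c)
    (σ : ProbabilityMeasure (X × Y)) : ⨆ n, truncatedCost c n σ = planCost c σ := by
  simp only [truncatedCost, planCost]
  rw [← lintegral_iSup (fun n => (hc.min measurable_const).coe_nnreal_ennreal)]
  · refine lintegral_congr fun p => le_antisymm (iSup_le fun n => by simp) ?_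
    obtain ⟨n, hn⟩ := exists_nat_ge (c p)
    exact le_iSup_of_le n (by simp [hn])
  · intro m n hmn p
    dsimp only
    gcongr

theorem continuous_truncatedCost [TopologicalSpace X] [TopologicalSpace Y]
    [OpensMeasurableSpace (X × Y)] {c : X × Y → ℝ≥0} (hc : Continuous c) (n : ℕ) :
    Continuous (truncatedCost c n) :=
  ProbabilityMeasure.continuous_lintegral_boundedContinuousFunction
    (BoundedContinuousFunction.mkOfBound ⟨fun p => min (c p) n, hc.min continuous_const⟩ n
      fun p q => by
        rw [NNReal.dist_eq]
        exact abs_sub_le_of_nonneg_of_le (NNReal.coe_nonneg _) (by simp) (NNReal.coe_nonneg _)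
          (by simp))

theorem measurable_truncatedCost {T : Type*} [MeasurableSpace T] {h : T × X × Y → ℝ≥0}
    (hh : Measurable h) (n : ℕ) (σ : ProbabilityMeasure (X × Y)) :
    Measurable fun t => truncatedCost (fun p => h (t, p)) n σ :=
  (hh.min measurable_const).coe_nnreal_ennreal.lintegral_prod_right'

end TruncatedCost

/-- Every measurable set is a Souslin set. -/
theorem le_souslinSigmaAlgebra {T : Type*} (𝒯 : MeasurableSpace T) : 𝒯 ≤ souslinSigmaAlgebra 𝒯 :=
  fun A hA => MeasurableSpace.measurableSet_generateFrom
    ⟨fun _ => A, fun _ => hA, by simp [iInter_const, iUnion_const]⟩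

theorem mainTheorem3 {T X Y : Type*} [𝒯 : MeasurableSpace T]
    [TopologicalSpace X] [PolishSpace X] [MeasurableSpace X] [BorelSpace X]
    [TopologicalSpace Y] [PolishSpace Y] [MeasurableSpace Y] [BorelSpace Y]
    (h : T × X × Y → ℝ≥0) (h_meas : Measurable h)
    (h_cont : ∀ t : T, Continuous fun p : X × Y => h (t, p))
    (μ : T → ProbabilityMeasure X) (hμ : Measurable[𝒯, borel (ProbabilityMeasure X)] μ)
    (ν : T → ProbabilityMeasure Y) (hν : Measurable[𝒯, borel (ProbabilityMeasure Y)] ν)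
    (h_fin : ∀ t : T, transportCost (fun p => h (t, p)) (μ t) (ν t) < ∞) :
    Measurable[𝒯] (fun t : T => transportCost (fun p => h (t, p)) (μ t) (ν t)) ∧
    ∃ σ : T → ProbabilityMeasure (X × Y),
      Measurable[souslinSigmaAlgebra 𝒯, borel (ProbabilityMeasure (X × Y))] σ ∧
      ∀ t : T, IsOptimalPlan (fun p => h (t, p)) (μ t) (ν t) (σ t) := by
  have := ProbabilityMeasure.secondCountableTopology (Z := X × Y)
  have hPi := measurableCompactValued_transportPlans hμ hν
  let G : ℕ → T → ProbabilityMeasure (X × Y) → ℝ≥0∞ :=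
    fun n t => truncatedCost (fun p => h (t, p)) n
  have hGm : ∀ n σ, Measurable fun t => G n t σ := measurable_truncatedCost h_meas
  have hGc : ∀ n t, Continuous (G n t) := fun n t => continuous_truncatedCost (h_cont t) n
  have hGs : ∀ t σ, ⨆ n, G n t σ = planCost (fun p => h (t, p)) σ :=
    fun t σ => iSup_truncatedCost (h_cont t).measurable σ
  let K : T → ℝ≥0∞ := fun t => ⨆ n, ⨅ σ ∈ transportPlans (μ t) (ν t), G n t σ
  have hK : Measurable K := .iSup fun n => hPi.measurable_iInf (hGm n) (hGc n)
  have hKle : ∀ t, K t ≤ transportCost (fun p => h (t, p)) (μ t) (ν t) := fun t =>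
    iSup_le fun n => iInf₂_mono fun σ _ => (le_iSup (G · t σ) n).trans (hGs t σ).le
  let M : ℕ → T → Set (ProbabilityMeasure (X × Y)) :=
    fun n t => transportPlans (μ t) (ν t) ∩ {σ | G n t σ ≤ K t}
  have hM : ∀ n, MeasurableCompactValued (M n) := fun n => hPi.sublevel (hGm n) (hGc n) hK
  have hanti : ∀ n t, M (n + 1) t ⊆ M n t := fun n t σ hσ =>
    ⟨hσ.1, (truncatedCost_mono _ σ n.le_succ).trans hσ.2⟩
  have hne : ∀ n t, (M n t).Nonempty := by
    intro n t
    obtain ⟨σ, hσ, hmin⟩ := (hPi.isCompact t).exists_isMinOn (transportPlans_nonempty _ _)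
      (hGc n t).continuousOn
    exact ⟨σ, hσ, (le_iInf₂ fun v hv => hmin hv).trans
      (le_iSup (fun n => ⨅ σ ∈ transportPlans (μ t) (ν t), G n t σ) n)⟩
  obtain ⟨σ, hσm, hσ⟩ := (MeasurableCompactValued.iInter hM hanti).exists_measurable_selection
    fun t => by
      simpa using MeasurableCompactValued.iInter_nonempty hM hanti isClosed_univ (t := t)
        (by simpa using hne · t)
  have hplan : ∀ t, σ t ∈ transportPlans (μ t) (ν t) := fun t => (mem_iInter.1 (hσ t) 0).1
  have hcost : ∀ t, planCost (fun p => h (t, p)) (σ t) ≤ K t := fun t =>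
    (hGs t (σ t)).symm.le.trans (iSup_le fun n => (mem_iInter.1 (hσ t) n).2)
  have hle : ∀ t, transportCost (fun p => h (t, p)) (μ t) (ν t) ≤
      planCost (fun p => h (t, p)) (σ t) := fun t => iInf₂_le _ (hplan t)
  -- The selection is already `𝒯`-measurable; passing to the Souslin σ-algebra only weakens this.
  refine ⟨?_, σ, hσm.mono (le_souslinSigmaAlgebra 𝒯) le_rfl, fun t =>
    ⟨hplan t, le_antisymm ((hcost t).trans (hKle t)) (hle t)⟩⟩
  convert hK using 2 with t
  exact le_antisymm ((hle t).trans (hcost t)) (hKle t)
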